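/- Let $a,c\in\mathbb R$ with $c<0<a$ and $c<-a-c<a$, let $y\in[c,-a-c]$, and put $q=\sqrt{\frac{2c+a}{c-a}}\in(0,1)$, $\omega=\sqrt{\frac{a-c}{6}}$. Let $F(\gamma,q)=\int_0^\gamma\frac{d\alpha}{\sqrt{1-q^2\sin^2\alpha}}$, let $\mathrm{sn},\mathrm{cn},\mathrm{dn}$ be the Jacobi elliptic functions of modulus $q$ (so $\mathrm{sn}(u,q)=\sin\gamma$ and $\mathrm{cn}(u,q)=\cos\gamma$ for $u=F(\gamma,q)$, and $\mathrm{dn}=\sqrt{1-q^2\mathrm{sn}^2}$), let $\mathcal E(u,q)=\int_0^u\mathrm{dn}^2(t,q)\,dt$, and put $i_y=F\big(\arcsin\sqrt{\tfrac{c-y}{2c+a}},q\big)$. Let $$x_0(t)=c-(a+2c)\,\mathrm{sn}^2(\omega t+i_y,q),\qquad t\ge 0 .$$ Let $u_1=\mathrm{sn}\,\mathrm{cn}\,\mathrm{dn}$ and $$u_2(t)=(-1+q^2)+(-2q^6+3q^4-5q^2+2)\,\mathrm{cn}^2(t,q)+2q^2(q^4-q^2+1)\,\mathrm{cn}^4(t,q)+\big[(-q^4+3q^2-2)\,t+2(q^4-q^2+1)\,\mathcal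 E(t,q)\big]u_1(t),$$ and put $w_1(t)=k_1u_1(\omega t+i_y)$, $w_2(t)=k_2u_2(\omega t+i_y)$, where the constants $k_1,k_2$ satisfy $-k_1k_2\,\omega(1-q^2)^2=1$ (that is, the Wronskian $w_1\dot w_2-\dot w_1w_2$ equals $1$). Let $\mathcal K(t,s)=w_2(t)w_1(s)-w_1(t)w_2(s)$. Let $B$ be a standard one-dimensional Brownian motion on a probability space $(\Omega,\mathcal F,\mathbb P)$, and let $\{\mathcal F^B_t\}_{t\ge0}$ be its filtration, augmented by the $\mathbb P$-null events. Let $x_1$ be a global strong solution, adapted to $\{\mathcal F^B_t\}$, of $\ddot x_1=2x_0x_1+\dot B$, $x_1(0)=\dot x_1(0)=0$, that is, of the system $dx_1=\xi_1\,dt$, $d\xi_1=2x_0x_1\,dt+dB$, $x_1(0)=\xi_1(0)=0$; and, inductively for $n\ge2$, let $x_n$ be a global strong solution, adapted to $\{\mathcal F^B_t\}$, of the random linear equation $$\ddot x_n(t)=2x_0(t)x_n(t)+\sum_{j=1}^{n-1}x_j(t)x_{n-j}(t),\qquad x_n(0)=\dot x_n(0)=0 .\tag{$*$}$$ **Theorem.**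 Let $n\ge2$. Processes $x_1,\dots,x_{n-1}$ as above exist, and for every such choice of them equation $(*)$ has a global strong solution $x_n$ on $[0,\infty)$ adapted to $\{\mathcal F^B_t\}_{t\ge0}$, unique up to indistinguishability. Almost surely, for all $t\ge0$, $$x_n(t)=w_2(t)\int_0^tw_1(s)\Big(\sum_{j=1}^{n-1}x_j(s)x_{n-j}(s)\Big)ds-w_1(t)\int_0^tw_2(s)\Big(\sum_{j=1}^{n-1}x_j(s)x_{n-j}(s)\Big)ds,$$ or equivalently $$x_n(t)=\int_0^t\mathcal K(t,s)\Big(\sum_{j=1}^{n-1}x_j(s)x_{n-j}(s)\Big)ds .$$ -/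

import Mathlib

open MeasureTheory ProbabilityTheory
open scoped NNReal

namespace LameExpansion

noncomputable section

/-! ### Elliptic integral and Jacobi elliptic functions of modulus `q` (used for `0 < q < 1`) -/

/-- Incomplete elliptic integral of the first kind `F(φ, q)`. -/
def ellipticF (φ q : ℝ) : ℝ :=
  ∫ α in (0 : ℝ)..φ, 1 / Real.sqrt (1 - q ^ 2 * Real.sin α ^ 2)

/-- Jacobi amplitude: the inverse of `φ ↦ F(φ, q)`, a bijection of `ℝ` when `0 ≤ q < 1`. -/
def jacobiAm (u q : ℝ) : ℝ := Function.invFun (fun φ : ℝ => ellipticF φ q) u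

/-- `sn(u, q) = sin γ`, where `u = F(γ, q)`. -/
def jacobiSn (u q : ℝ) : ℝ := Real.sin (jacobiAm u q)

/-- `cn(u, q) = cos γ`, where `u = F(γ, q)`. -/
def jacobiCn (u q : ℝ) : ℝ := Real.cos (jacobiAm u q)

/-- `dn(u, q) = √(1 - q² sn²(u, q))`. -/
def jacobiDn (u q : ℝ) : ℝ := Real.sqrt (1 - q ^ 2 * jacobiSn u q ^ 2)

/-- Jacobi's Epsilon function `∫₀ᵘ dn²(t, q) dt`. -/
def jacobiEpsilon (u q : ℝ) : ℝ := ∫ t in (0 : ℝ)..u, jacobiDn t q ^ 2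

/-! ### The unperturbed solution `x₀`

The cubic `(x - a)(x + a + c)(x - c) / 3` has the roots `c < -a-c < a`, and `y ∈ [c, -a-c]` is the
initial position. -/

/-- The modulus `q = √((2c + a) / (c - a))`. -/
def modulus (a c : ℝ) : ℝ := Real.sqrt ((2 * c + a) / (c - a))

/-- The frequency `√((a - c) / 6)`. -/
def freq (a c : ℝ) : ℝ := Real.sqrt ((a - c) / 6)

/-- The phase `i_y = F(arcsin √((c - y) / (2c + a)), q)`. -/
def phase (a c y : ℝ) : ℝ :=
  ellipticF (Real.arcsin (Real.sqrt ((c - y) / (2 * c + a)))) (modulus a c)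

/-- `x₀(t) = c - (a + 2c) sn²(√((a - c)/6) t + i_y, q)`. -/
def xZero (a c y t : ℝ) : ℝ :=
  c - (a + 2 * c) * jacobiSn (freq a c * t + phase a c y) (modulus a c) ^ 2

/-! ### The two solutions of the Lamé equation and the kernel -/

/-- `u₁ = sn cn dn`. -/
def lameU1 (q t : ℝ) : ℝ := jacobiSn t q * jacobiCn t q * jacobiDn t q

/-- The second solution
`u₂ = α₀ + α₁ cn² + α₂ cn⁴ + (β₀ t + β₁ 𝓔) u₁`. -/
def lameU2 (q t : ℝ) : ℝ :=
  ((-1 + q ^ 2)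
    + (-2 * q ^ 6 + 3 * q ^ 4 - 5 * q ^ 2 + 2) * jacobiCn t q ^ 2
    + (2 * q ^ 2 * (q ^ 4 - q ^ 2 + 1)) * jacobiCn t q ^ 4)
  + ((-q ^ 4 + 3 * q ^ 2 - 2) * t
    + (2 * (q ^ 4 - q ^ 2 + 1)) * jacobiEpsilon t q) * lameU1 q t

/-- `w₁(t) = k₁ u₁(√((a - c)/6) t + i_y)`, with a normalizing constant `k₁`. -/
def wOne (a c y k₁ t : ℝ) : ℝ := k₁ * lameU1 (modulus a c) (freq a c * t + phase a c y)

/-- `w₂(t) = k₂ u₂(√((a - c)/6) t + i_y)`, with a normalizing constant `k₂`. -/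
def wTwo (a c y k₂ t : ℝ) : ℝ := k₂ * lameU2 (modulus a c) (freq a c * t + phase a c y)

/-- For `k₁ = k₂ = 1` the Wronskian of `(w₁, w₂)` is the constant `-√((a - c)/6) (1 - q²)²`, so this
condition on the normalizing constants says that the Wronskian of `(w₁, w₂)` is `1`. -/
def WronskianNormalized (a c k₁ k₂ : ℝ) : Prop :=
  k₁ * k₂ * (-(freq a c * (1 - modulus a c ^ 2) ^ 2)) = 1

/-- `K(t, s) = w₂(t) w₁(s) - w₁(t) w₂(s)`. -/
def kernelK (a c y k₁ k₂ t s : ℝ) : ℝ :=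
  wTwo a c y k₂ t * wOne a c y k₁ s - wOne a c y k₁ t * wTwo a c y k₂ s

/-! ### The stochastic equations -/

variable {Ω : Type*} {mΩ : MeasurableSpace Ω}

/-- The Brownian filtration: `𝓕ᴮ_t` is generated by `B_s`, `s ≤ t`, and the `P`-null events. -/
def brownianFiltration (B : ℝ≥0 → Ω → ℝ) (hB : ∀ t, Measurable (B t)) (P : Measure Ω) :
    Filtration ℝ≥0 mΩ where
  seq t := (⨆ s ≤ t, MeasurableSpace.comap (B s) inferInstance) ⊔
    MeasurableSpace.generateFrom {N | MeasurableSet N ∧ P N = 0}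
  mono' _ _ hij := sup_le_sup_right (biSup_mono fun _ h => h.trans hij) _
  le' _ := sup_le (iSup₂_le fun s _ => (hB s).comap_le)
    (MeasurableSpace.generateFrom_le fun _ h => h.1)

/-- The path `t ↦ X_t(ω)` as a function of real time (only its values at `t ≥ 0` matter). -/
def path (X : ℝ≥0 → Ω → ℝ) (ω : Ω) (t : ℝ) : ℝ := X t.toNNReal ω

/-- `z` is a global strong solution, adapted to the filtration `𝓕`, of
`z̈ = 2 x₀ z + Ḃ`, `z(0) = ż(0) = 0`, that is, of the system
`dz = ξ dt`, `dξ = 2 x₀ z dt + dB`, `z(0) = ξ(0) = 0`. -/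
def IsStrongSolutionOne (𝓕 : Filtration ℝ≥0 mΩ) (P : Measure Ω) (x₀ : ℝ → ℝ)
    (B z : ℝ≥0 → Ω → ℝ) : Prop :=
  Adapted 𝓕 z ∧ ∃ ξ : ℝ≥0 → Ω → ℝ, Adapted 𝓕 ξ ∧
    ∀ᵐ ω ∂P, z 0 ω = 0 ∧ ξ 0 ω = 0 ∧
      (∀ t : ℝ≥0, HasDerivWithinAt (path z ω) (ξ t ω) (Set.Ici 0) (t : ℝ)) ∧
      (∀ t : ℝ≥0, ξ t ω =
        (∫ s in (0 : ℝ)..t, 2 * x₀ s * path z ω s) + (B t ω - B 0 ω))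

/-- `∑_{j=1}^{n-1} x_j(s) x_{n-j}(s)` along the path `ω`. -/
def forcing (n : ℕ) (x : ℕ → ℝ≥0 → Ω → ℝ) (ω : Ω) (s : ℝ) : ℝ :=
  ∑ j ∈ Finset.Ico 1 n, path (x j) ω s * path (x (n - j)) ω s

/-- `z` is a global strong solution, adapted to the filtration `𝓕`, of
`z̈ = 2 x₀ z + ∑_{j=1}^{n-1} x_j x_{n-j}`, `z(0) = ż(0) = 0`, that is, of the system
`ż = ξ`, `ξ̇ = 2 x₀ z + ∑_{j=1}^{n-1} x_j x_{n-j}`, `z(0) = ξ(0) = 0`. -/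
def IsStrongSolution (𝓕 : Filtration ℝ≥0 mΩ) (P : Measure Ω) (x₀ : ℝ → ℝ)
    (n : ℕ) (x : ℕ → ℝ≥0 → Ω → ℝ) (z : ℝ≥0 → Ω → ℝ) : Prop :=
  Adapted 𝓕 z ∧ ∃ ξ : ℝ≥0 → Ω → ℝ, Adapted 𝓕 ξ ∧
    ∀ᵐ ω ∂P, z 0 ω = 0 ∧ ξ 0 ω = 0 ∧
      (∀ t : ℝ≥0, HasDerivWithinAt (path z ω) (ξ t ω) (Set.Ici 0) (t : ℝ)) ∧
      (∀ t : ℝ≥0, HasDerivWithinAt (path ξ ω)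
        (2 * x₀ t * z t ω + forcing n x ω t) (Set.Ici 0) (t : ℝ))

/-- `x 1, …, x (n - 1)` are the coefficient processes below level `n` (for `n ≥ 2`): `x 1` solves
`ẍ₁ = 2 x₀ x₁ + Ḃ`, and each `x m` with `2 ≤ m < n` solves
`ẍ_m = 2 x₀ x_m + ∑_{j=1}^{m-1} x_j x_{m-j}`, all with zero initial data. -/
def IsCoefficientFamilyBelow (𝓕 : Filtration ℝ≥0 mΩ) (P : Measure Ω) (x₀ : ℝ → ℝ)
    (B : ℝ≥0 → Ω → ℝ) (n : ℕ) (x : ℕ → ℝ≥0 → Ω → ℝ) : Prop :=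
  IsStrongSolutionOne 𝓕 P x₀ B (x 1) ∧
    ∀ m, 2 ≤ m → m < n → IsStrongSolution 𝓕 P x₀ m x (x m)

end

end LameExpansion

/-!
Along each path, a process of the expansion solves a linear system `z' = ξ + β`, `ξ' = p z + f` with
`p = 2 x₀`: for `x₁` the path `β` is the Brownian one and `f = 0`, for `xₙ` with `n ≥ 2` it is
`β = 0` and `f` is the quadratic forcing. Writing the noise as `β` makes every equation an ordinary
differential equation with continuous coefficients, so no stochastic integral is needed.

If `w'' = p w`, then `w ξ - w' z` has derivative `w f - w' β`. Two such identities, for solutions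
`w₁`, `w₂` with Wronskian `1`, determine `z`, which gives uniqueness and the formula at once;
conversely the formula defines a solution, and it is adapted because its value at time `t` is an
integral over `[0, t]`.

The functions `w₁`, `w₂` are rescalings of solutions `u₁`, `u₂` of Lamé's equation
`u'' = (12 q² sn² - 4 (1 + q²)) u`. In both `u₂' = m u₁ + L u₁'` and `u₂ = α + L u₁` the secular
factor `L` multiplies a solution, and `α`, `m`, `L'`, `u₁'` and `u₁²` are polynomials in `sn²`, so
that Lamé's equation for `u₂` and the value of the Wronskian are polynomial identities.
-/

namespace LameExpansion

open Set Filter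

/-! ### Jacobi elliptic functions -/

section ExpandingMaps

variable {f : ℝ → ℝ}

lemma strictMono_of_monotone_sub_id (hf : Monotone fun x => f x - x) : StrictMono f := by
  intro x y hxy
  have := hf hxy.le
  dsimp only at this
  linarith

lemma surjective_of_monotone_sub_id (hc : Continuous f) (hf : Monotone fun x => f x - x) :
    Function.Surjective f := by
  refine hc.surjective ?_ ?_
  · refine tendsto_atTop_mono' _ ?_ (tendsto_atTop_add_const_right _ (f 0) tendsto_id)
    filter_upwards [eventually_ge_atTop 0] with x hx
    linarith [hf hx, id_eq x]
  · refine tendsto_atBot_mono' _ ?_ (tendsto_atBot_add_const_right _ (f 0) tendsto_id)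
    filter_upwards [eventually_le_atBot 0] with x hx
    linarith [hf hx, id_eq x]

end ExpandingMaps

section Jacobi

variable {q : ℝ}

lemma one_sub_sq_mul_sin_sq_pos (hq : q ^ 2 < 1) (α : ℝ) :
    0 < 1 - q ^ 2 * Real.sin α ^ 2 := by
  nlinarith [Real.sin_sq_le_one α, sq_nonneg q, sq_nonneg (Real.sin α)]

lemma one_le_ellipticF_integrand (hq : q ^ 2 < 1) (α : ℝ) :
    1 ≤ 1 / Real.sqrt (1 - q ^ 2 * Real.sin α ^ 2) := by
  rw [one_le_div (Real.sqrt_pos.2 (one_sub_sq_mul_sin_sq_pos hq α)), Real.sqrt_le_one]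
  exact sub_le_self _ (by positivity)

lemma hasDerivAt_ellipticF (hq : q ^ 2 < 1) (φ : ℝ) :
    HasDerivAt (fun φ => ellipticF φ q) (1 / Real.sqrt (1 - q ^ 2 * Real.sin φ ^ 2)) φ := by
  have hc : Continuous fun α : ℝ => 1 / Real.sqrt (1 - q ^ 2 * Real.sin α ^ 2) :=
    continuous_const.div (by fun_prop)
      fun α => (Real.sqrt_pos.2 (one_sub_sq_mul_sin_sq_pos hq α)).ne'
  exact (hc.integral_hasStrictDerivAt 0 φ).hasDerivAt

lemma continuous_ellipticF (hq : q ^ 2 < 1) : Continuous fun φ => ellipticF φ q :=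
  continuous_iff_continuousAt.2 fun φ => (hasDerivAt_ellipticF hq φ).continuousAt

lemma monotone_ellipticF_sub_id (hq : q ^ 2 < 1) : Monotone fun φ => ellipticF φ q - φ := by
  have h (φ : ℝ) : HasDerivAt (fun φ => ellipticF φ q - φ)
      (1 / Real.sqrt (1 - q ^ 2 * Real.sin φ ^ 2) - 1) φ :=
    (hasDerivAt_ellipticF hq φ).sub (hasDerivAt_id φ)
  refine monotone_of_deriv_nonneg (fun φ => (h φ).differentiableAt) fun φ => ?_
  rw [(h φ).deriv]
  exact sub_nonneg.2 (one_le_ellipticF_integrand hq φ)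

lemma strictMono_ellipticF (hq : q ^ 2 < 1) : StrictMono fun φ => ellipticF φ q :=
  strictMono_of_monotone_sub_id (monotone_ellipticF_sub_id hq)

lemma ellipticF_jacobiAm (hq : q ^ 2 < 1) (u : ℝ) : ellipticF (jacobiAm u q) q = u :=
  Function.rightInverse_invFun
    (surjective_of_monotone_sub_id (continuous_ellipticF hq) (monotone_ellipticF_sub_id hq)) u

lemma jacobiAm_ellipticF (hq : q ^ 2 < 1) (φ : ℝ) : jacobiAm (ellipticF φ q) q = φ :=
  Function.leftInverse_invFun (strictMono_ellipticF hq).injective φ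

lemma continuous_jacobiAm (hq : q ^ 2 < 1) : Continuous fun u => jacobiAm u q := by
  have hmono : Monotone fun u => jacobiAm u q := fun u v huv => by
    rwa [← (strictMono_ellipticF hq).le_iff_le, ellipticF_jacobiAm hq, ellipticF_jacobiAm hq]
  exact hmono.continuous_of_surjective fun φ => ⟨ellipticF φ q, jacobiAm_ellipticF hq φ⟩

lemma hasDerivAt_jacobiAm (hq : q ^ 2 < 1) (u : ℝ) :
    HasDerivAt (fun u => jacobiAm u q) (jacobiDn u q) u := by
  have hpos := Real.sqrt_pos.2 (one_sub_sq_mul_sin_sq_pos hq (jacobiAm u q))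
  have h := HasDerivAt.of_local_left_inverse (continuous_jacobiAm hq).continuousAt
    (hasDerivAt_ellipticF hq (jacobiAm u q)) (one_div_pos.2 hpos).ne'
    (Eventually.of_forall (ellipticF_jacobiAm hq))
  rwa [one_div, inv_inv] at h

lemma hasDerivAt_jacobiSn (hq : q ^ 2 < 1) (u : ℝ) :
    HasDerivAt (fun u => jacobiSn u q) (jacobiCn u q * jacobiDn u q) u :=
  (hasDerivAt_jacobiAm hq u).sin

lemma continuous_jacobiSn (hq : q ^ 2 < 1) : Continuous fun u => jacobiSn u q :=
  Real.continuous_sin.comp (continuous_jacobiAm hq)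

lemma hasDerivAt_jacobiCn (hq : q ^ 2 < 1) (u : ℝ) :
    HasDerivAt (fun u => jacobiCn u q) (-jacobiSn u q * jacobiDn u q) u :=
  (hasDerivAt_jacobiAm hq u).cos

lemma jacobiCn_sq (u q : ℝ) : jacobiCn u q ^ 2 = 1 - jacobiSn u q ^ 2 :=
  Real.cos_sq' _

lemma jacobiDn_sq (hq : q ^ 2 < 1) (u : ℝ) : jacobiDn u q ^ 2 = 1 - q ^ 2 * jacobiSn u q ^ 2 :=
  Real.sq_sqrt (one_sub_sq_mul_sin_sq_pos hq _).le

lemma continuous_jacobiDn (hq : q ^ 2 < 1) : Continuous fun u => jacobiDn u q :=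
  (continuous_const.sub (continuous_const.mul ((continuous_jacobiSn hq).pow 2))).sqrt

lemma hasDerivAt_jacobiDn (hq : q ^ 2 < 1) (u : ℝ) :
    HasDerivAt (fun u => jacobiDn u q) (-q ^ 2 * jacobiSn u q * jacobiCn u q) u := by
  have hpos : 0 < 1 - q ^ 2 * jacobiSn u q ^ 2 := one_sub_sq_mul_sin_sq_pos hq _
  have hdn : jacobiDn u q ≠ 0 := (Real.sqrt_pos.2 hpos).ne'
  refine (((((hasDerivAt_jacobiSn hq u).fun_pow 2).const_mul (q ^ 2)).const_sub 1).sqrt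
    hpos.ne').congr_deriv ?_
  rw [← jacobiDn, div_eq_iff (mul_ne_zero two_ne_zero hdn)]
  push_cast
  ring

lemma hasDerivAt_jacobiEpsilon (hq : q ^ 2 < 1) (u : ℝ) :
    HasDerivAt (fun u => jacobiEpsilon u q) (jacobiDn u q ^ 2) u :=
  (((continuous_jacobiDn hq).pow 2).integral_hasStrictDerivAt 0 u).hasDerivAt

end Jacobi

/-! ### Linear second-order equations -/

/-- `w` is a solution on `ℝ` of the homogeneous equation `w'' = p w`, with derivative `v`. -/
structure IsHomogeneousSolution (p w v : ℝ → ℝ) : Prop where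
  hasDerivAt : ∀ t, HasDerivAt w (v t) t
  hasDerivAt_deriv : ∀ t, HasDerivAt v (p t * w t) t

/-- `w₁` and `w₂` are solutions of `w'' = p w`, with derivatives `v₁` and `v₂`, whose Wronskian
is `1`. -/
structure IsFundamentalPair (p w₁ v₁ w₂ v₂ : ℝ → ℝ) : Prop where
  fst : IsHomogeneousSolution p w₁ v₁
  snd : IsHomogeneousSolution p w₂ v₂
  wronskian : ∀ t, w₁ t * v₂ t - v₁ t * w₂ t = 1

/-- `(z, ξ)` is a solution on `[0, ∞)` of the system `z' = ξ + β`, `ξ' = p z + f` with zero initial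
data, that is, of `z'' = p z + f + β'` for a possibly nowhere differentiable `β`. -/
structure IsForcedSolution (p β f z ξ : ℝ → ℝ) : Prop where
  fst_zero : z 0 = 0
  snd_zero : ξ 0 = 0
  hasDerivWithinAt_fst : ∀ t : ℝ≥0, HasDerivWithinAt z (ξ t + β t) (Ici 0) t
  hasDerivWithinAt_snd : ∀ t : ℝ≥0, HasDerivWithinAt ξ (p t * z t + f t) (Ici 0) t

/-- The pairing on `[0, t]` of the forcing `f + β'` with a function `w` that has the derivative `v`.
The term `w β'` is integrated by parts, and its boundary term is left out. -/
noncomputable def forcingPairing (w v β f : ℝ → ℝ) (t : ℝ) : ℝ :=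
  ∫ s in (0 : ℝ)..t, (w s * f s - v s * β s)

lemma integral_eq_sub_of_hasDerivWithinAt_Ici {E : Type*} [NormedAddCommGroup E] [NormedSpace ℝ E]
    [CompleteSpace E] {g g' : ℝ → E} (hg : ∀ t : ℝ≥0, HasDerivWithinAt g (g' t) (Ici 0) t)
    (hg' : Continuous g') (t : ℝ≥0) : ∫ s in (0 : ℝ)..t, g' s = g t - g 0 :=
  intervalIntegral.integral_eq_sub_of_hasDeriv_right_of_le t.coe_nonneg
    (fun s hs => (hg ⟨s, hs.1⟩).continuousWithinAt.mono Icc_subset_Ici_self)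
    (fun s hs => (hg ⟨s, hs.1.le⟩).mono fun _ hr => hs.1.le.trans hr.le)
    (hg'.intervalIntegrable 0 t)

lemma forcingPairing_apply_zero (w v β f : ℝ → ℝ) : forcingPairing w v β f 0 = 0 :=
  intervalIntegral.integral_same

lemma forcingPairing_zero_noise (w v f : ℝ → ℝ) (t : ℝ) :
    forcingPairing w v 0 f t = ∫ s in (0 : ℝ)..t, w s * f s := by
  simp [forcingPairing]

namespace IsHomogeneousSolution

variable {p w v β f z ξ : ℝ → ℝ}

lemma continuous (h : IsHomogeneousSolution p w v) : Continuous w :=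
  continuous_iff_continuousAt.2 fun t => (h.hasDerivAt t).continuousAt

lemma continuous_deriv (h : IsHomogeneousSolution p w v) : Continuous v :=
  continuous_iff_continuousAt.2 fun t => (h.hasDerivAt_deriv t).continuousAt

lemma const_mul (h : IsHomogeneousSolution p w v) (k : ℝ) :
    IsHomogeneousSolution p (fun t => k * w t) (fun t => k * v t) where
  hasDerivAt t := (h.hasDerivAt t).const_mul k
  hasDerivAt_deriv t := ((h.hasDerivAt_deriv t).const_mul k).congr_deriv (by ring)

lemma comp_affine (h : IsHomogeneousSolution p w v) (ω τ : ℝ) :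
    IsHomogeneousSolution (fun t => ω ^ 2 * p (ω * t + τ)) (fun t => w (ω * t + τ))
      (fun t => ω * v (ω * t + τ)) := by
  have haff (t : ℝ) : HasDerivAt (fun t => ω * t + τ) ω t := by
    simpa using ((hasDerivAt_id t).const_mul ω).add_const τ
  exact
    { hasDerivAt t := ((h.hasDerivAt _).comp t (haff t)).congr_deriv (by ring)
      hasDerivAt_deriv t :=
        (((h.hasDerivAt_deriv _).comp t (haff t)).const_mul ω).congr_deriv (by ring) }

lemma hasDerivAt_forcingPairing (h : IsHomogeneousSolution p w v) (hβ : Continuous β)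
    (hf : Continuous f) (t : ℝ) :
    HasDerivAt (forcingPairing w v β f) (w t * f t - v t * β t) t :=
  have hint := (h.continuous.mul hf).sub (h.continuous_deriv.mul hβ)
  (hint.integral_hasStrictDerivAt 0 t).hasDerivAt

lemma mul_sub_mul_eq_forcingPairing (h : IsHomogeneousSolution p w v) (hβ : Continuous β)
    (hf : Continuous f) (hz : IsForcedSolution p β f z ξ) (t : ℝ≥0) :
    w t * ξ t - v t * z t = forcingPairing w v β f t := by
  have hderiv (s : ℝ≥0) : HasDerivWithinAt (fun s => w s * ξ s - v s * z s)
      (w s * f s - v s * β s) (Ici 0) s :=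
    (((h.hasDerivAt s).hasDerivWithinAt.mul (hz.hasDerivWithinAt_snd s)).sub
      ((h.hasDerivAt_deriv s).hasDerivWithinAt.mul (hz.hasDerivWithinAt_fst s))).congr_deriv
      (by ring)
  have hint : Continuous fun s => w s * f s - v s * β s :=
    (h.continuous.mul hf).sub (h.continuous_deriv.mul hβ)
  have hftc := integral_eq_sub_of_hasDerivWithinAt_Ici hderiv hint t
  simpa [forcingPairing, hz.fst_zero, hz.snd_zero] using hftc.symm

end IsHomogeneousSolution

lemma IsForcedSolution.congr {p β f z ξ z' ξ' : ℝ → ℝ} (h : IsForcedSolution p β f z ξ)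
    (hz : EqOn z' z (Ici 0)) (hξ : EqOn ξ' ξ (Ici 0)) : IsForcedSolution p β f z' ξ' where
  fst_zero := (hz self_mem_Ici).trans h.fst_zero
  snd_zero := (hξ self_mem_Ici).trans h.snd_zero
  hasDerivWithinAt_fst t := by
    rw [hξ (mem_Ici.2 t.coe_nonneg)]
    exact (h.hasDerivWithinAt_fst t).congr hz (hz t.2)
  hasDerivWithinAt_snd t := by
    rw [hz (mem_Ici.2 t.coe_nonneg)]
    exact (h.hasDerivWithinAt_snd t).congr hξ (hξ t.2)

namespace IsFundamentalPair

variable {p w₁ v₁ w₂ v₂ β f z ξ : ℝ → ℝ}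

lemma eq_variation_of_constants (h : IsFundamentalPair p w₁ v₁ w₂ v₂) (hβ : Continuous β)
    (hf : Continuous f) (hz : IsForcedSolution p β f z ξ) (t : ℝ≥0) :
    z t = w₂ t * forcingPairing w₁ v₁ β f t - w₁ t * forcingPairing w₂ v₂ β f t := by
  rw [← h.fst.mul_sub_mul_eq_forcingPairing hβ hf hz,
    ← h.snd.mul_sub_mul_eq_forcingPairing hβ hf hz]
  linear_combination (-z t) * h.wronskian t

lemma isForcedSolution_variation_of_constants (h : IsFundamentalPair p w₁ v₁ w₂ v₂)
    (hβ : Continuous β) (hf : Continuous f) :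
    IsForcedSolution p β f
      (fun t => w₂ t * forcingPairing w₁ v₁ β f t - w₁ t * forcingPairing w₂ v₂ β f t)
      (fun t => v₂ t * forcingPairing w₁ v₁ β f t - v₁ t * forcingPairing w₂ v₂ β f t) where
  fst_zero := by simp only [forcingPairing_apply_zero, mul_zero, sub_zero]
  snd_zero := by simp only [forcingPairing_apply_zero, mul_zero, sub_zero]
  hasDerivWithinAt_fst t := by
    refine (((h.snd.hasDerivAt t).mul (h.fst.hasDerivAt_forcingPairing hβ hf t)).sub
      ((h.fst.hasDerivAt t).mul (h.snd.hasDerivAt_forcingPairing hβ hf t))).hasDerivWithinAt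
      |>.congr_deriv ?_
    linear_combination β t * h.wronskian t
  hasDerivWithinAt_snd t := by
    refine (((h.snd.hasDerivAt_deriv t).mul (h.fst.hasDerivAt_forcingPairing hβ hf t)).sub
      ((h.fst.hasDerivAt_deriv t).mul (h.snd.hasDerivAt_forcingPairing hβ hf t))).hasDerivWithinAt
      |>.congr_deriv ?_
    linear_combination f t * h.wronskian t

end IsFundamentalPair

lemma mul_integral_sub_mul_integral {w₁ w₂ f : ℝ → ℝ} (h₁ : Continuous w₁) (h₂ : Continuous w₂)
    (hf : Continuous f) (x y a b : ℝ) :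
    x * (∫ s in a..b, w₁ s * f s) - y * (∫ s in a..b, w₂ s * f s)
      = ∫ s in a..b, (x * w₁ s - y * w₂ s) * f s := by
  simp only [← intervalIntegral.integral_const_mul]
  rw [← intervalIntegral.integral_sub]
  · exact intervalIntegral.integral_congr fun s _ => by ring
  · exact (continuous_const.mul (h₁.mul hf)).intervalIntegrable a b
  · exact (continuous_const.mul (h₂.mul hf)).intervalIntegrable a b

/-! ### Lamé's equation -/

/-- The potential of Lamé's equation `u'' = (N (N + 1) q² sn² - h) u` for `N = 3` and
`h = 4 (1 + q²)`, the equation solved by `lameU1` and `lameU2`. -/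
noncomputable def lamePotential (q t : ℝ) : ℝ :=
  12 * q ^ 2 * jacobiSn t q ^ 2 - 4 * (1 + q ^ 2)

/-- The derivative of `lameU1`, as a polynomial in `sn²`. -/
noncomputable def lameU1Deriv (q t : ℝ) : ℝ :=
  1 - 2 * (1 + q ^ 2) * jacobiSn t q ^ 2 + 3 * q ^ 2 * jacobiSn t q ^ 4

/-- The coefficient of `lameU1` in the second solution `lameU2`; it contains the terms of `lameU2`
that are not elliptic functions. -/
noncomputable def lameSecular (q t : ℝ) : ℝ :=
  (-q ^ 4 + 3 * q ^ 2 - 2) * t + 2 * (q ^ 4 - q ^ 2 + 1) * jacobiEpsilon t q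

/-- The derivative of `lameU2`, with the secular terms collected in the multiple of
`lameU1Deriv`. -/
noncomputable def lameU2Deriv (q t : ℝ) : ℝ :=
  (-4 * q ^ 6 + 3 * q ^ 4 + 3 * q ^ 2 - 4
      + 6 * q ^ 2 * (q ^ 4 - q ^ 2 + 1) * jacobiSn t q ^ 2) * lameU1 q t
    + lameSecular q t * lameU1Deriv q t

section Lame

variable {q : ℝ}

lemma lameU1_sq (hq : q ^ 2 < 1) (t : ℝ) :
    lameU1 q t ^ 2
      = jacobiSn t q ^ 2 * (1 - jacobiSn t q ^ 2) * (1 - q ^ 2 * jacobiSn t q ^ 2) := by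
  rw [lameU1, mul_pow, mul_pow, jacobiCn_sq, jacobiDn_sq hq]

lemma hasDerivAt_jacobiSn_sq (hq : q ^ 2 < 1) (t : ℝ) :
    HasDerivAt (fun t => jacobiSn t q ^ 2) (2 * lameU1 q t) t :=
  ((hasDerivAt_jacobiSn hq t).fun_pow 2).congr_deriv (by rw [lameU1]; push_cast; ring)

lemma hasDerivAt_lameU1 (hq : q ^ 2 < 1) (t : ℝ) : HasDerivAt (lameU1 q) (lameU1Deriv q t) t := by
  refine (((hasDerivAt_jacobiSn hq t).mul (hasDerivAt_jacobiCn hq t)).mul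
    (hasDerivAt_jacobiDn hq t)).congr_deriv ?_
  simp only [lameU1Deriv, Pi.mul_apply]
  linear_combination (jacobiCn t q ^ 2 - jacobiSn t q ^ 2) * jacobiDn_sq hq t
    + (1 - 2 * q ^ 2 * jacobiSn t q ^ 2) * jacobiCn_sq t q

lemma isHomogeneousSolution_lameU1 (hq : q ^ 2 < 1) :
    IsHomogeneousSolution (lamePotential q) (lameU1 q) (lameU1Deriv q) where
  hasDerivAt := hasDerivAt_lameU1 hq
  hasDerivAt_deriv t := by
    have hs := hasDerivAt_jacobiSn_sq hq t
    have h := ((hs.const_mul (2 * (1 + q ^ 2))).const_sub 1).add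
      ((hs.fun_pow 2).const_mul (3 * q ^ 2))
    refine (h.congr_of_eventuallyEq (.of_forall fun r => ?_)).congr_deriv ?_
    · simp only [lameU1Deriv, Pi.add_apply]
      ring
    · simp only [lamePotential]
      push_cast
      ring

lemma hasDerivAt_lameSecular (hq : q ^ 2 < 1) (t : ℝ) :
    HasDerivAt (lameSecular q)
      (-q ^ 4 + 3 * q ^ 2 - 2 + 2 * (q ^ 4 - q ^ 2 + 1) * (1 - q ^ 2 * jacobiSn t q ^ 2)) t := by
  rw [← jacobiDn_sq hq]
  exact (((hasDerivAt_id t).const_mul (-q ^ 4 + 3 * q ^ 2 - 2)).add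
    ((hasDerivAt_jacobiEpsilon hq t).const_mul (2 * (q ^ 4 - q ^ 2 + 1)))).congr_deriv (by ring)

lemma lameU2_eq (q t : ℝ) :
    lameU2 q t = -1 + q ^ 2
      + (-2 * q ^ 6 + 3 * q ^ 4 - 5 * q ^ 2 + 2) * (1 - jacobiSn t q ^ 2)
      + 2 * q ^ 2 * (q ^ 4 - q ^ 2 + 1) * (1 - jacobiSn t q ^ 2) ^ 2
      + lameSecular q t * lameU1 q t := by
  rw [← jacobiCn_sq, lameU2, lameSecular]
  ring

lemma hasDerivAt_lameU2 (hq : q ^ 2 < 1) (t : ℝ) : HasDerivAt (lameU2 q) (lameU2Deriv q t) t := by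
  have hc := (hasDerivAt_jacobiSn_sq hq t).const_sub 1
  have h := (((hc.const_mul (-2 * q ^ 6 + 3 * q ^ 4 - 5 * q ^ 2 + 2)).const_add
    (-1 + q ^ 2)).add ((hc.fun_pow 2).const_mul (2 * q ^ 2 * (q ^ 4 - q ^ 2 + 1)))).add
    ((hasDerivAt_lameSecular hq t).mul (hasDerivAt_lameU1 hq t))
  refine (h.congr_of_eventuallyEq (.of_forall (lameU2_eq q))).congr_deriv ?_
  rw [lameU2Deriv]
  push_cast
  ring

lemma isHomogeneousSolution_lameU2 (hq : q ^ 2 < 1) :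
    IsHomogeneousSolution (lamePotential q) (lameU2 q) (lameU2Deriv q) where
  hasDerivAt := hasDerivAt_lameU2 hq
  hasDerivAt_deriv t := by
    have h := ((((hasDerivAt_jacobiSn_sq hq t).const_mul
      (6 * q ^ 2 * (q ^ 4 - q ^ 2 + 1))).const_add
      (-4 * q ^ 6 + 3 * q ^ 4 + 3 * q ^ 2 - 4)).mul (hasDerivAt_lameU1 hq t)).add
      ((hasDerivAt_lameSecular hq t).mul
        ((isHomogeneousSolution_lameU1 hq).hasDerivAt_deriv t))
    refine h.congr_deriv ?_
    rw [lameU2_eq, lamePotential, lameU1Deriv]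
    linear_combination 12 * q ^ 2 * (q ^ 4 - q ^ 2 + 1) * lameU1_sq hq t

lemma lame_wronskian (hq : q ^ 2 < 1) (t : ℝ) :
    lameU1 q t * lameU2Deriv q t - lameU1Deriv q t * lameU2 q t = -(1 - q ^ 2) ^ 2 := by
  rw [lameU2_eq, lameU2Deriv, lameU1Deriv]
  linear_combination (-4 * q ^ 6 + 3 * q ^ 4 + 3 * q ^ 2 - 4
    + 6 * q ^ 2 * (q ^ 4 - q ^ 2 + 1) * jacobiSn t q ^ 2) * lameU1_sq hq t

end Lame

section Parameters

variable {a c : ℝ}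

lemma modulus_sq (hac : 2 * c + a ≤ 0) (hca : c ≤ a) :
    modulus a c ^ 2 = (2 * c + a) / (c - a) :=
  Real.sq_sqrt (div_nonneg_of_nonpos hac (sub_nonpos.2 hca))

lemma modulus_sq_lt_one (hac : 2 * c + a < 0) (hca : -a - c < a) : modulus a c ^ 2 < 1 := by
  rw [modulus_sq hac.le (by linarith), div_lt_one_of_neg (by linarith)]
  linarith

lemma freq_sq (hca : c ≤ a) : freq a c ^ 2 = (a - c) / 6 :=
  Real.sq_sqrt (by linarith)

lemma continuous_xZero (hq : modulus a c ^ 2 < 1) (y : ℝ) : Continuous (xZero a c y) :=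
  continuous_const.sub (continuous_const.mul
    (((continuous_jacobiSn hq).comp (by fun_prop)).pow 2))

lemma freq_sq_mul_lamePotential (hac : 2 * c + a ≤ 0) (hca : c < a) (y t : ℝ) :
    freq a c ^ 2 * lamePotential (modulus a c) (freq a c * t + phase a c y)
      = 2 * xZero a c y t := by
  have hca₀ : c - a ≠ 0 := (sub_neg.2 hca).ne
  rw [lamePotential, xZero, freq_sq hca.le, modulus_sq hac hca.le]
  field_simp
  ring

lemma isFundamentalPair_wOne_wTwo (hac : 2 * c + a < 0) (hca : -a - c < a) (y : ℝ) {k₁ k₂ : ℝ}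
    (hk : WronskianNormalized a c k₁ k₂) :
    IsFundamentalPair (fun t => 2 * xZero a c y t)
      (wOne a c y k₁)
      (fun t => k₁ * (freq a c * lameU1Deriv (modulus a c) (freq a c * t + phase a c y)))
      (wTwo a c y k₂)
      (fun t => k₂ * (freq a c * lameU2Deriv (modulus a c) (freq a c * t + phase a c y))) := by
  have hq := modulus_sq_lt_one hac hca
  simp only [← freq_sq_mul_lamePotential hac.le (show c < a by linarith) y]
  exact
    { fst := ((isHomogeneousSolution_lameU1 hq).comp_affine _ _).const_mul k₁
      snd := ((isHomogeneousSolution_lameU2 hq).comp_affine _ _).const_mul k₂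
      wronskian := fun t => by
        rw [wOne, wTwo, ← hk]
        linear_combination k₁ * k₂ * freq a c * lame_wronskian hq (freq a c * t + phase a c y) }

end Parameters

/-! ### Adapted processes -/

section Adapted

variable {Ω : Type*} {mΩ : MeasurableSpace Ω} {P : Measure Ω}

/-- The filtration `𝓕` contains the measurable `P`-null events, so that changing a process on such
an event keeps it adapted. -/
def ContainsNullEvents {ι : Type*} [Preorder ι] (𝓕 : Filtration ι mΩ) (P : Measure Ω) : Prop :=
  ∀ N, MeasurableSet N → P N = 0 → ∀ t, MeasurableSet[𝓕 t] N

lemma ContainsNullEvents.exists_adapted_continuous {ι E : Type*} [Preorder ι] [TopologicalSpace ι]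
    [TopologicalSpace E] [MeasurableSpace E] [Zero E] {𝓕 : Filtration ι mΩ} {X : ι → Ω → E}
    (h𝓕 : ContainsNullEvents 𝓕 P) (hX : Adapted 𝓕 X) (hc : ∀ᵐ ω ∂P, Continuous fun t => X t ω) :
    ∃ Y : ι → Ω → E, Adapted 𝓕 Y ∧ (∀ ω, Continuous fun t => Y t ω) ∧
      ∀ᵐ ω ∂P, ∀ t, Y t ω = X t ω := by
  obtain ⟨N, hsub, hN, hN₀⟩ := exists_measurable_superset_of_null (ae_iff.1 hc)
  refine ⟨fun t => Nᶜ.indicator (X t), fun t => (hX t).indicator (h𝓕 N hN hN₀ t).compl,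
    fun ω => ?_, ?_⟩
  · by_cases hω : ω ∈ N
    · simpa [hω] using continuous_const
    · simpa [hω] using not_not.1 fun h => hω (hsub h)
  · filter_upwards [measure_eq_zero_iff_ae_notMem.1 hN₀] with ω hω t
    exact indicator_of_mem hω _

lemma stronglyMeasurable_intervalIntegral_of_continuous {E : Type*} [NormedAddCommGroup E]
    [NormedSpace ℝ E] {Y : ℝ → Ω → E} (hY : ∀ s, StronglyMeasurable (Y s))
    (hc : ∀ ω, Continuous fun s => Y s ω) (a b : ℝ) :
    StronglyMeasurable fun ω => ∫ s in a..b, Y s ω :=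
  have hm : StronglyMeasurable (Function.uncurry Y) :=
    stronglyMeasurable_uncurry_of_continuous_of_stronglyMeasurable hc hY
  hm.integral_prod_left.sub hm.integral_prod_left

lemma stronglyAdapted_integral {E : Type*} [NormedAddCommGroup E] [NormedSpace ℝ E]
    {𝓕 : Filtration ℝ≥0 mΩ} {Y : ℝ → Ω → E} (hY : StronglyAdapted 𝓕 fun t : ℝ≥0 => Y t)
    (hc : ∀ ω, Continuous fun s => Y s ω) :
    StronglyAdapted 𝓕 fun t ω => ∫ s in (0 : ℝ)..t, Y s ω := by
  intro t
  -- Freezing the process at time `t` makes it `𝓕 t`-measurable without changing the integral.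
  have hstopped := stronglyMeasurable_intervalIntegral_of_continuous (mΩ := 𝓕 t)
    (Y := fun s ω => Y (min s.toNNReal t : ℝ≥0) ω)
    (fun s => (hY (min s.toNNReal t)).mono (𝓕.mono (min_le_right _ _)))
    (fun ω => (hc ω).comp (by fun_prop)) 0 t
  convert hstopped using 2 with ω
  refine intervalIntegral.integral_congr fun s hs => ?_
  rw [uIcc_of_le t.coe_nonneg] at hs
  simp only [min_eq_left (Real.toNNReal_le_iff_le_coe.2 hs.2), Real.coe_toNNReal s hs.1]

lemma containsNullEvents_brownianFiltration {B : ℝ≥0 → Ω → ℝ} (hB : ∀ t, Measurable (B t)) :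
    ContainsNullEvents (brownianFiltration B hB P) P := fun N hN hN₀ _ =>
  (le_sup_right : MeasurableSpace.generateFrom {N | MeasurableSet N ∧ P N = 0} ≤ _) N
    (MeasurableSpace.measurableSet_generateFrom ⟨hN, hN₀⟩)

lemma adapted_brownianFiltration {B : ℝ≥0 → Ω → ℝ} (hB : ∀ t, Measurable (B t)) :
    Adapted (brownianFiltration B hB P) B := fun t =>
  measurable_iff_comap_le.2 (le_sup_of_le_left (le_iSup₂_of_le t le_rfl le_rfl))

end Adapted

section Path

variable {Ω : Type*} {X : ℝ≥0 → Ω → ℝ} {ω : Ω}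

lemma path_coe (X : ℝ≥0 → Ω → ℝ) (ω : Ω) (t : ℝ≥0) : path X ω t = X t ω := by
  rw [path, Real.toNNReal_coe]

lemma path_zero (X : ℝ≥0 → Ω → ℝ) (ω : Ω) : path X ω 0 = X 0 ω :=
  path_coe X ω 0

lemma eqOn_path (Z : ℝ → Ω → ℝ) (ω : Ω) :
    EqOn (path (fun t ω => Z t ω) ω) (fun t => Z t ω) (Ici 0) := fun t ht => by
  rw [path, Real.coe_toNNReal t ht]

lemma path_forcing (n : ℕ) (x : ℕ → ℝ≥0 → Ω → ℝ) (ω : Ω) :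
    path (fun t ω => forcing n x ω t) ω = forcing n x ω := by
  ext s
  simp only [path, forcing, Real.toNNReal_coe]

lemma continuous_path_iff : Continuous (path X ω) ↔ Continuous fun t => X t ω := by
  refine ⟨fun h => ?_, fun h => h.comp continuous_real_toNNReal⟩
  simpa only [Function.comp_def, path_coe] using h.comp NNReal.continuous_coe

lemma continuous_of_hasDerivWithinAt_path {f : ℝ≥0 → ℝ}
    (h : ∀ t : ℝ≥0, HasDerivWithinAt (path X ω) (f t) (Ici 0) t) :
    Continuous fun t => X t ω := by
  have hc : ContinuousOn (path X ω) (Ici 0) := fun t ht => (h ⟨t, ht⟩).continuousWithinAt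
  simpa only [Function.comp_def, path_coe] using
    hc.comp_continuous NNReal.continuous_coe fun t => t.coe_nonneg

end Path

/-! ### Strong solutions -/

section StrongSolutions

variable {Ω : Type*} {mΩ : MeasurableSpace Ω} {𝓕 : Filtration ℝ≥0 mΩ} {P : Measure Ω}
  {p x₀ w₁ v₁ w₂ v₂ : ℝ → ℝ} {B : ℝ≥0 → Ω → ℝ} {n : ℕ} {x : ℕ → ℝ≥0 → Ω → ℝ}
  {z z' : ℝ≥0 → Ω → ℝ}

lemma IsHomogeneousSolution.adapted_forcingPairing {w v : ℝ → ℝ}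
    (h : IsHomogeneousSolution p w v) {β f : ℝ≥0 → Ω → ℝ}
    (hβ : Adapted 𝓕 β) (hβc : ∀ ω, Continuous fun t => β t ω)
    (hf : Adapted 𝓕 f) (hfc : ∀ ω, Continuous fun t => f t ω) :
    Adapted 𝓕 fun (t : ℝ≥0) ω => forcingPairing w v (path β ω) (path f ω) t := by
  refine (stronglyAdapted_integral
    (Y := fun s ω => w s * path f ω s - v s * path β ω s)
    (Adapted.stronglyAdapted fun t => ?_) fun ω => ?_).adapted
  · simp only [path_coe]
    exact ((hf t).const_mul (w t)).sub ((hβ t).const_mul (v t))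
  · exact (h.continuous.mul (continuous_path_iff.2 (hfc ω))).sub
      (h.continuous_deriv.mul (continuous_path_iff.2 (hβc ω)))

theorem IsFundamentalPair.exists_adapted_isForcedSolution
    (hw : IsFundamentalPair p w₁ v₁ w₂ v₂) (h𝓕 : ContainsNullEvents 𝓕 P) {β f : ℝ≥0 → Ω → ℝ}
    (hβ : Adapted 𝓕 β) (hβc : ∀ᵐ ω ∂P, Continuous fun t => β t ω)
    (hf : Adapted 𝓕 f) (hfc : ∀ᵐ ω ∂P, Continuous fun t => f t ω) :
    ∃ z ξ : ℝ≥0 → Ω → ℝ, Adapted 𝓕 z ∧ Adapted 𝓕 ξ ∧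
      ∀ᵐ ω ∂P, IsForcedSolution p (path β ω) (path f ω) (path z ω) (path ξ ω) := by
  obtain ⟨β', hβ', hβ'c, hββ'⟩ := h𝓕.exists_adapted_continuous hβ hβc
  obtain ⟨f', hf', hf'c, hff'⟩ := h𝓕.exists_adapted_continuous hf hfc
  have h₁ := hw.fst.adapted_forcingPairing hβ' hβ'c hf' hf'c
  have h₂ := hw.snd.adapted_forcingPairing hβ' hβ'c hf' hf'c
  let combination (u₁ u₂ : ℝ → ℝ) (t : ℝ) (ω : Ω) : ℝ :=
    u₂ t * forcingPairing w₁ v₁ (path β' ω) (path f' ω) t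
      - u₁ t * forcingPairing w₂ v₂ (path β' ω) (path f' ω) t
  refine ⟨fun t => combination w₁ w₂ t, fun t => combination v₁ v₂ t,
    fun t => ((h₁ t).const_mul (w₂ t)).sub ((h₂ t).const_mul (w₁ t)),
    fun t => ((h₁ t).const_mul (v₂ t)).sub ((h₂ t).const_mul (v₁ t)), ?_⟩
  filter_upwards [hββ', hff'] with ω hβω hfω
  rw [show path β ω = path β' ω from funext fun s => (hβω _).symm,
    show path f ω = path f' ω from funext fun s => (hfω _).symm]
  exact (hw.isForcedSolution_variation_of_constants (continuous_path_iff.2 (hβ'c ω))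
    (continuous_path_iff.2 (hf'c ω))).congr
    (eqOn_path (combination w₁ w₂) ω) (eqOn_path (combination v₁ v₂) ω)

lemma isForcedSolution_path_iff {f : ℝ → ℝ} {ξ : ℝ≥0 → Ω → ℝ} {ω : Ω} :
    IsForcedSolution p 0 f (path z ω) (path ξ ω) ↔ z 0 ω = 0 ∧ ξ 0 ω = 0 ∧
      (∀ t : ℝ≥0, HasDerivWithinAt (path z ω) (ξ t ω) (Ici 0) t) ∧
      (∀ t : ℝ≥0, HasDerivWithinAt (path ξ ω) (p t * z t ω + f t) (Ici 0) t) := by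
  rw [← path_zero z, ← path_zero ξ]
  simp only [← path_coe z, ← path_coe ξ]
  exact ⟨fun h => ⟨h.1, h.2, by simpa using h.3, h.4⟩,
    fun h => ⟨h.1, h.2.1, by simpa using h.2.2.1, h.2.2.2⟩⟩

lemma isStrongSolution_iff :
    IsStrongSolution 𝓕 P x₀ n x z ↔ Adapted 𝓕 z ∧ ∃ ξ : ℝ≥0 → Ω → ℝ, Adapted 𝓕 ξ ∧
      ∀ᵐ ω ∂P, IsForcedSolution (fun t => 2 * x₀ t) 0 (forcing n x ω) (path z ω) (path ξ ω) := by
  simp only [IsStrongSolution, isForcedSolution_path_iff]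

lemma isStrongSolutionOne_of_isForcedSolution (hx₀ : Continuous x₀) {η : ℝ≥0 → Ω → ℝ}
    (hB : Adapted 𝓕 B) (hz : Adapted 𝓕 z) (hη : Adapted 𝓕 η)
    (h : ∀ᵐ ω ∂P, IsForcedSolution (fun t => 2 * x₀ t) (path (fun t ω => B t ω - B 0 ω) ω) 0
      (path z ω) (path η ω)) :
    IsStrongSolutionOne 𝓕 P x₀ B z := by
  refine ⟨hz, fun t ω => η t ω + (B t ω - B 0 ω),
    hη.add (hB.sub fun t => hB.measurable_le zero_le), ?_⟩
  filter_upwards [h] with ω hω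
  have hzη := hω.hasDerivWithinAt_fst
  have hη₀ := hω.snd_zero
  simp only [path_coe, path_zero] at hzη hη₀
  refine ⟨by simpa only [path_zero] using hω.fst_zero, by simp [hη₀], hzη, fun t => ?_⟩
  have hz_cont : Continuous fun s => 2 * x₀ s * path z ω s :=
    (continuous_const.mul hx₀).mul
      (continuous_path_iff.2 (continuous_of_hasDerivWithinAt_path hzη))
  have hftc := integral_eq_sub_of_hasDerivWithinAt_Ici
    (by simpa only [Pi.zero_apply, add_zero] using hω.hasDerivWithinAt_snd) hz_cont t
  rw [hftc, path_coe, path_zero, hη₀, sub_zero]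

theorem exists_isStrongSolutionOne (h𝓕 : ContainsNullEvents 𝓕 P)
    (hw : IsFundamentalPair (fun t => 2 * x₀ t) w₁ v₁ w₂ v₂) (hx₀ : Continuous x₀)
    (hB : Adapted 𝓕 B) (hBc : ∀ᵐ ω ∂P, Continuous fun t => B t ω) :
    ∃ z, IsStrongSolutionOne 𝓕 P x₀ B z := by
  obtain ⟨z, η, hz, hη, hsol⟩ := hw.exists_adapted_isForcedSolution h𝓕
    (β := fun t ω => B t ω - B 0 ω) (f := 0)
    (fun t => (hB t).sub (hB.measurable_le zero_le))
    (hBc.mono fun ω h => h.sub continuous_const)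
    (fun _ => measurable_const) (.of_forall fun _ => continuous_const)
  exact ⟨z, isStrongSolutionOne_of_isForcedSolution hx₀ hB hz hη hsol⟩

lemma IsStrongSolutionOne.ae_continuous (h : IsStrongSolutionOne 𝓕 P x₀ B z) :
    ∀ᵐ ω ∂P, Continuous fun t => z t ω := by
  obtain ⟨-, ξ, -, h⟩ := h
  filter_upwards [h] with ω hω using continuous_of_hasDerivWithinAt_path hω.2.2.1

lemma IsStrongSolution.ae_continuous (h : IsStrongSolution 𝓕 P x₀ n x z) :
    ∀ᵐ ω ∂P, Continuous fun t => z t ω := by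
  obtain ⟨-, ξ, -, h⟩ := h
  filter_upwards [h] with ω hω using continuous_of_hasDerivWithinAt_path hω.2.2.1

lemma forcing_congr {x' : ℕ → ℝ≥0 → Ω → ℝ} (h : ∀ j < n, x j = x' j) :
    forcing n x = forcing n x' := by
  ext ω s
  refine Finset.sum_congr rfl fun j hj => ?_
  rw [Finset.mem_Ico] at hj
  rw [h j hj.2, h (n - j) (by lia)]

lemma isStrongSolution_congr {x' : ℕ → ℝ≥0 → Ω → ℝ} (h : ∀ j < n, x j = x' j) :
    IsStrongSolution 𝓕 P x₀ n x z ↔ IsStrongSolution 𝓕 P x₀ n x' z := by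
  simp only [IsStrongSolution, forcing_congr h]

namespace IsCoefficientFamilyBelow

lemma adapted (h : IsCoefficientFamilyBelow 𝓕 P x₀ B n x) {j : ℕ} (hj : 1 ≤ j) (hjn : j < n) :
    Adapted 𝓕 (x j) := by
  rcases hj.eq_or_lt with rfl | hj
  · exact h.1.1
  · exact (h.2 j hj hjn).1

lemma ae_continuous (h : IsCoefficientFamilyBelow 𝓕 P x₀ B n x) {j : ℕ} (hj : 1 ≤ j)
    (hjn : j < n) : ∀ᵐ ω ∂P, Continuous fun t => x j t ω := by
  rcases hj.eq_or_lt with rfl | hj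
  · exact h.1.ae_continuous
  · exact (h.2 j hj hjn).ae_continuous

lemma adapted_forcing (h : IsCoefficientFamilyBelow 𝓕 P x₀ B n x) :
    Adapted 𝓕 fun t ω => forcing n x ω t := by
  intro t
  refine Finset.measurable_sum _ fun j hj => ?_
  rw [Finset.mem_Ico] at hj
  simp only [path_coe]
  exact (h.adapted hj.1 hj.2 t).mul (h.adapted (by lia) (by lia) t)

lemma ae_continuous_forcing (h : IsCoefficientFamilyBelow 𝓕 P x₀ B n x) :
    ∀ᵐ ω ∂P, Continuous (forcing n x ω) := by
  have hc : ∀ᵐ ω ∂P, ∀ j ∈ Finset.Ico 1 n, Continuous fun t => x j t ω :=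
    (Finset.Ico 1 n).eventually_all.2 fun j hj =>
      h.ae_continuous (Finset.mem_Ico.1 hj).1 (Finset.mem_Ico.1 hj).2
  filter_upwards [hc] with ω hω
  refine continuous_finsetSum _ fun j hj => ?_
  have hj' : n - j ∈ Finset.Ico 1 n := by rw [Finset.mem_Ico] at hj ⊢; lia
  exact (continuous_path_iff.2 (hω j hj)).mul (continuous_path_iff.2 (hω _ hj'))

theorem exists_isStrongSolution (h : IsCoefficientFamilyBelow 𝓕 P x₀ B n x)
    (h𝓕 : ContainsNullEvents 𝓕 P) (hw : IsFundamentalPair (fun t => 2 * x₀ t) w₁ v₁ w₂ v₂) :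
    ∃ z, IsStrongSolution 𝓕 P x₀ n x z := by
  obtain ⟨z, ξ, hz, hξ, hsol⟩ := hw.exists_adapted_isForcedSolution h𝓕 (β := 0)
    (fun _ => measurable_const) (.of_forall fun _ => continuous_const) h.adapted_forcing
    (h.ae_continuous_forcing.mono fun ω hω => hω.comp NNReal.continuous_coe)
  simp only [path_forcing] at hsol
  exact ⟨z, isStrongSolution_iff.2 ⟨hz, ξ, hξ, hsol⟩⟩

theorem ae_eq_variation_of_constants (h : IsCoefficientFamilyBelow 𝓕 P x₀ B n x)
    (hw : IsFundamentalPair (fun t => 2 * x₀ t) w₁ v₁ w₂ v₂)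
    (hz : IsStrongSolution 𝓕 P x₀ n x z) :
    ∀ᵐ ω ∂P, ∀ t : ℝ≥0, z t ω = w₂ t * (∫ s in (0 : ℝ)..t, w₁ s * forcing n x ω s)
      - w₁ t * ∫ s in (0 : ℝ)..t, w₂ s * forcing n x ω s := by
  obtain ⟨-, ξ, -, hz⟩ := isStrongSolution_iff.1 hz
  filter_upwards [hz, h.ae_continuous_forcing] with ω hω hf t
  simpa only [path_coe, forcingPairing_zero_noise] using
    hw.eq_variation_of_constants continuous_zero hf hω t

theorem ae_eq_integral_kernel (h : IsCoefficientFamilyBelow 𝓕 P x₀ B n x)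
    (hw : IsFundamentalPair (fun t => 2 * x₀ t) w₁ v₁ w₂ v₂)
    (hz : IsStrongSolution 𝓕 P x₀ n x z) :
    ∀ᵐ ω ∂P, ∀ t : ℝ≥0,
      z t ω = ∫ s in (0 : ℝ)..t, (w₂ t * w₁ s - w₁ t * w₂ s) * forcing n x ω s := by
  filter_upwards [h.ae_eq_variation_of_constants hw hz, h.ae_continuous_forcing] with ω hω hf t
  rw [hω, mul_integral_sub_mul_integral hw.fst.continuous hw.snd.continuous hf]

theorem ae_eq_of_isStrongSolution (h : IsCoefficientFamilyBelow 𝓕 P x₀ B n x)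
    (hw : IsFundamentalPair (fun t => 2 * x₀ t) w₁ v₁ w₂ v₂)
    (hz : IsStrongSolution 𝓕 P x₀ n x z) (hz' : IsStrongSolution 𝓕 P x₀ n x z') :
    ∀ᵐ ω ∂P, ∀ t, z t ω = z' t ω := by
  filter_upwards [h.ae_eq_variation_of_constants hw hz,
    h.ae_eq_variation_of_constants hw hz'] with ω hω hω' t
  rw [hω, hω']

lemma update (h : IsCoefficientFamilyBelow 𝓕 P x₀ B n x) (hn : 2 ≤ n)
    (hz : IsStrongSolution 𝓕 P x₀ n x z) :
    IsCoefficientFamilyBelow 𝓕 P x₀ B (n + 1) (Function.update x n z) := by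
  refine ⟨?_, fun m h2 hm => ?_⟩
  · rw [Function.update_of_ne (by lia)]
    exact h.1
  · rw [← isStrongSolution_congr (x := x)
      fun j hj => (Function.update_of_ne (by lia) _ _).symm]
    rcases (Nat.lt_succ_iff.1 hm).eq_or_lt with rfl | hm
    · rwa [Function.update_self]
    · rw [Function.update_of_ne hm.ne]
      exact h.2 m h2 hm

end IsCoefficientFamilyBelow

theorem exists_isCoefficientFamilyBelow (h𝓕 : ContainsNullEvents 𝓕 P)
    (hw : IsFundamentalPair (fun t => 2 * x₀ t) w₁ v₁ w₂ v₂) (hx₀ : Continuous x₀)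
    (hB : Adapted 𝓕 B) (hBc : ∀ᵐ ω ∂P, Continuous fun t => B t ω) (n : ℕ) :
    ∃ x, IsCoefficientFamilyBelow 𝓕 P x₀ B n x := by
  obtain ⟨z, hz⟩ := exists_isStrongSolutionOne h𝓕 hw hx₀ hB hBc
  induction n with
  | zero => exact ⟨fun _ => z, hz, fun m _ hm => absurd hm m.not_lt_zero⟩
  | succ n ih =>
    by_cases hn : 2 ≤ n
    · obtain ⟨x, hx⟩ := ih
      obtain ⟨z, hz⟩ := hx.exists_isStrongSolution h𝓕 hw
      exact ⟨Function.update x n z, hx.update hn hz⟩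
    · exact ⟨fun _ => z, hz, fun m h2 hm => by lia⟩

end StrongSolutions

end LameExpansion

open LameExpansion in
theorem mainTheorem6_general {Ω : Type*} {mΩ : MeasurableSpace Ω} {P : Measure Ω}
    {𝓕 : Filtration ℝ≥0 mΩ} (h𝓕 : ContainsNullEvents 𝓕 P) {B : ℝ≥0 → Ω → ℝ} (hB : Adapted 𝓕 B)
    (hBc : ∀ᵐ ω ∂P, Continuous fun t => B t ω) {x₀ w₁ v₁ w₂ v₂ : ℝ → ℝ} (hx₀ : Continuous x₀)
    (hw : IsFundamentalPair (fun t => 2 * x₀ t) w₁ v₁ w₂ v₂) (n : ℕ) :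
    (∃ x, IsCoefficientFamilyBelow 𝓕 P x₀ B n x) ∧
    ∀ x, IsCoefficientFamilyBelow 𝓕 P x₀ B n x →
      (∃ z, IsStrongSolution 𝓕 P x₀ n x z) ∧
      (∀ z z', IsStrongSolution 𝓕 P x₀ n x z → IsStrongSolution 𝓕 P x₀ n x z' →
        ∀ᵐ ω ∂P, ∀ t : ℝ≥0, z t ω = z' t ω) ∧
      (∀ z, IsStrongSolution 𝓕 P x₀ n x z →
        ∀ᵐ ω ∂P, ∀ t : ℝ≥0,
          z t ω = w₂ t * (∫ s in (0 : ℝ)..t, w₁ s * forcing n x ω s)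
            - w₁ t * (∫ s in (0 : ℝ)..t, w₂ s * forcing n x ω s) ∧
          z t ω = ∫ s in (0 : ℝ)..t, (w₂ t * w₁ s - w₁ t * w₂ s) * forcing n x ω s) := by
  refine ⟨exists_isCoefficientFamilyBelow h𝓕 hw hx₀ hB hBc n, fun x hx =>
    ⟨hx.exists_isStrongSolution h𝓕 hw, fun z z' => hx.ae_eq_of_isStrongSolution hw,
      fun z hz => ?_⟩⟩
  filter_upwards [hx.ae_eq_variation_of_constants hw hz, hx.ae_eq_integral_kernel hw hz]
    with ω hvar hker t
  exact ⟨hvar t, hker t⟩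

theorem mainTheorem6 {Ω : Type*} {mΩ : MeasurableSpace Ω} (P : Measure Ω) [IsProbabilityMeasure P]
    (B : ℝ≥0 → Ω → ℝ) (hBm : ∀ t, Measurable (B t)) (hB : IsBrownianReal B P)
    (a c y : ℝ) (hc : c < 0) (ha : 0 < a) (hac : 2 * c + a < 0) (hca : -a - c < a)
    (hy : y ∈ Set.Icc c (-a - c))
    (k₁ k₂ : ℝ) (hk : LameExpansion.WronskianNormalized a c k₁ k₂)
    (n : ℕ) (hn : 2 ≤ n) :
    -- the processes of lower order, on which the equation depends, exist
    (∃ x : ℕ → ℝ≥0 → Ω → ℝ, LameExpansion.IsCoefficientFamilyBelow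
      (LameExpansion.brownianFiltration B hBm P) P (LameExpansion.xZero a c y) B n x) ∧
    ∀ x : ℕ → ℝ≥0 → Ω → ℝ,
      LameExpansion.IsCoefficientFamilyBelow
        (LameExpansion.brownianFiltration B hBm P) P (LameExpansion.xZero a c y) B n x →
      -- existence
      (∃ z : ℝ≥0 → Ω → ℝ, LameExpansion.IsStrongSolution
        (LameExpansion.brownianFiltration B hBm P) P (LameExpansion.xZero a c y) n x z) ∧
      -- uniqueness, up to indistinguishability
      (∀ z z' : ℝ≥0 → Ω → ℝ,
        LameExpansion.IsStrongSolution
          (LameExpansion.brownianFiltration B hBm P) P (LameExpansion.xZero a c y) n x z →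
        LameExpansion.IsStrongSolution
          (LameExpansion.brownianFiltration B hBm P) P (LameExpansion.xZero a c y) n x z' →
        ∀ᵐ ω ∂P, ∀ t : ℝ≥0, z t ω = z' t ω) ∧
      -- the two forms of the explicit representation
      (∀ z : ℝ≥0 → Ω → ℝ,
        LameExpansion.IsStrongSolution
          (LameExpansion.brownianFiltration B hBm P) P (LameExpansion.xZero a c y) n x z →
        ∀ᵐ ω ∂P, ∀ t : ℝ≥0,
          z t ω = LameExpansion.wTwo a c y k₂ t *
              (∫ s in (0 : ℝ)..t, LameExpansion.wOne a c y k₁ s * LameExpansion.forcing n x ω s)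
            - LameExpansion.wOne a c y k₁ t *
              (∫ s in (0 : ℝ)..t, LameExpansion.wTwo a c y k₂ s * LameExpansion.forcing n x ω s) ∧
          z t ω =
            ∫ s in (0 : ℝ)..t, LameExpansion.kernelK a c y k₁ k₂ t s *
              LameExpansion.forcing n x ω s) := by
  exact mainTheorem6_general (LameExpansion.containsNullEvents_brownianFiltration hBm)
    (LameExpansion.adapted_brownianFiltration hBm) hB.cont
    (LameExpansion.continuous_xZero (LameExpansion.modulus_sq_lt_one hac hca) y)
    (LameExpansion.isFundamentalPair_wOne_wTwo hac hca y hk) n
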